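/- Let $n\ge 0$, $d=2^n$, and let $\mathcal G$ be a set of Pauli strings on $n$ qubits (a Pauli string is a tensor product $\sigma_1\otimes\cdots\otimes\sigma_n$ with each $\sigma_k\in\{I,X,Y,Z\}$, without phases, so there are $4^n$ of them). Let $\mathfrak g$ be the dynamical Lie algebra of $\mathcal G$, i.e. the smallest real Lie algebra of $d\times d$ complex matrices containing $i\mathcal G$; let $G=\exp\mathfrak g$ be the corresponding compact connected Lie subgroup of the unitary group $\mathbb U(d)$ (equivalently, the closed subgroup of $\mathbb U(d)$ generated by $\{e^{A}:A\in\mathfrak g\}$), and let $\mu_G$ be its Haar probability measure. The commutator graph of $\mathcal G$ has the $4^n$ Pauli strings as vertices, and $p,q$ are joined by an edge if there is $X\in\mathcal G$ such that $[p,X]$ is a nonzero multiple of $q$. Write $C(p)$ for the connected component of $p$ in this graph, $|C(p)|$ for its number of vertices, and $\langle A,B\rangle_{\mathrm{HS}}=\operatorname{tr}[A^\dagger B]$. Then, for all Pauli strings $V$ and $W$, the function $U\mapsto|\langle W,UVU^\dagger\rangle_{\mathrm{HS}}|^2$ is $\mu_G$-integrable and $$\mathbb E_{U\sim\mu_G}\,\bigl|\langle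 W,UVU^\dagger\rangle_{\mathrm{HS}}\bigr|^2=\begin{cases}\dfrac{d^2}{|C(V)|}&\text{if } C(V)=C(W),\\[1ex] 0&\text{otherwise.}\end{cases}$$ So, on average, an initial Pauli string evolved by a Haar-random $U\in G$ spreads uniformly over its connected component. -/

import Mathlib

open MeasureTheory
open scoped Matrix

noncomputable section

/-- Operators on the Hilbert space of `n` qubits, as matrices in the computational basis. The basis
states are labelled by bit strings, so the dimension of the Hilbert space is `d = 2 ^ n`. -/
abbrev QubitOp (n : ℕ) : Type := Matrix (Fin n → Fin 2) (Fin n → Fin 2) ℂ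

/-- The four single-qubit Pauli matrices `I, X, Y, Z`. -/
def pauliMatrix : Fin 4 → Matrix (Fin 2) (Fin 2) ℂ :=
  ![!![1, 0; 0, 1], !![0, 1; 1, 0], !![0, -Complex.I; Complex.I, 0], !![1, 0; 0, -1]]

/-- Labels of the `4 ^ n` Pauli strings on `n` qubits (no phases). -/
abbrev PauliString (n : ℕ) : Type := Fin n → Fin 4

/-- The operator of a Pauli string `s`: the tensor (Kronecker) product of the Pauli matrices
`pauliMatrix (s 0), …, pauliMatrix (s (n - 1))`. -/
def PauliString.op {n : ℕ} (s : PauliString n) : QubitOp n :=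
  Matrix.of fun i j => ∏ k, pauliMatrix (s k) (i k) (j k)

/-- The commutator graph of a set `𝒢` of Pauli strings: distinct strings `p`, `q` are joined when
`[p, X]` is a nonzero multiple of `q` for some `X ∈ 𝒢`. (This relation is already symmetric and
irreflexive, so that `SimpleGraph.fromRel` changes nothing.) -/
def commutatorGraph {n : ℕ} (𝒢 : Set (PauliString n)) : SimpleGraph (PauliString n) :=
  SimpleGraph.fromRel fun p q => ∃ X ∈ 𝒢, ∃ c : ℂ, c ≠ 0 ∧ p.op * X.op - X.op * p.op = c • q.op

/-- The connected component of `p` in the commutator graph. -/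
def component {n : ℕ} (𝒢 : Set (PauliString n)) (p : PauliString n) : Set (PauliString n) :=
  ((commutatorGraph 𝒢).connectedComponentMk p).supp

attribute [local instance 100] LieRing.ofAssociativeRing

/-- The dynamical Lie algebra (with bracket `[A, B] = A B - B A`): the smallest real Lie algebra of operators containing `i 𝒢`. -/
def dynamicalLieAlgebra {n : ℕ} (𝒢 : Set (PauliString n)) : LieSubalgebra ℝ (QubitOp n) :=
  LieSubalgebra.lieSpan ℝ (QubitOp n) ((fun p : PauliString n => Complex.I • p.op) '' 𝒢)

/-- The compact Lie group `G` of the dynamics: the closed subgroup of the unitary group `U(d)`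
generated by the exponentials of the elements of the dynamical Lie algebra. (A Lie algebra generated
by Pauli strings is that of a compact connected group, so this is the group
`exp 𝔤`; taking the topological closure adds no elements.) -/
def dynamicalGroup {n : ℕ} (𝒢 : Set (PauliString n)) :
    Subgroup (Matrix.unitaryGroup (Fin n → Fin 2) ℂ) :=
  (Subgroup.closure {U : Matrix.unitaryGroup (Fin n → Fin 2) ℂ |
    ∃ X ∈ dynamicalLieAlgebra 𝒢, (U : QubitOp n) = NormedSpace.exp X}).topologicalClosure

/-- The unitary group is compact. -/
instance unitaryGroup_compactSpace (n : ℕ) :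
    CompactSpace (Matrix.unitaryGroup (Fin n → Fin 2) ℂ) := by
  refine isCompact_iff_compactSpace (s := (unitary (QubitOp n) : Set (QubitOp n))).mp ?_
  have hK : IsCompact (Set.pi Set.univ fun _ : Fin n → Fin 2 =>
      Set.pi Set.univ fun _ : Fin n → Fin 2 => Metric.closedBall (0 : ℂ) 1) :=
    isCompact_univ_pi fun _ => isCompact_univ_pi fun _ => isCompact_closedBall _ _
  refine hK.of_isClosed_subset ?_ ?_
  · exact isClosed_unitary (R := QubitOp n)
  · intro U hU i _ j _
    simpa using entry_norm_bound_of_unitary hU i j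

instance dynamicalGroup_compactSpace {n : ℕ} (𝒢 : Set (PauliString n)) :
    CompactSpace (dynamicalGroup 𝒢) :=
  isCompact_iff_compactSpace.mp (Subgroup.isClosed_topologicalClosure _).isCompact

instance dynamicalGroup_measurableSpace {n : ℕ} (𝒢 : Set (PauliString n)) :
    MeasurableSpace (dynamicalGroup 𝒢) :=
  borel _

instance dynamicalGroup_borelSpace {n : ℕ} (𝒢 : Set (PauliString n)) :
    BorelSpace (dynamicalGroup 𝒢) :=
  ⟨rfl⟩

/-- The Haar measure `μ_G` on `G`, normalised to be a probability measure. -/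
def haarProbability {n : ℕ} (𝒢 : Set (PauliString n)) : Measure (dynamicalGroup 𝒢) :=
  Measure.haarMeasure ⊤

/-- The Hilbert–Schmidt inner product `⟨A, B⟩ = tr (A† B)`. -/
def hsInner {n : ℕ} (A B : QubitOp n) : ℂ := (Aᴴ * B).trace

/-- The evolved operator `U V U†` of a Pauli string `V`, for `U ∈ G`. -/
def evolve {n : ℕ} {𝒢 : Set (PauliString n)} (U : dynamicalGroup 𝒢) (V : PauliString n) :
    QubitOp n :=
  (U : QubitOp n) * V.op * (U : QubitOp n)ᴴ

end

/-! Two facts force uniform spreading. First, bracketing with a generator sends a Pauli string to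
zero or to a multiple of a neighbour, so the span of `C(V)` is stable under the Lie algebra, hence
under conjugation by `G` (`conj_mem_componentSpan`). The evolved `V` is thus orthogonal to strings
outside `C(V)`, and by Parseval its squared overlaps with `C(V)` sum to `d ^ 2` for every `U`.
Second, if `X ∈ 𝒢` joins `p` to `q`, then `exp (iπX/4) ∈ G` conjugates `p` to a phase times `q`
(`exists_evolve_eq_smul`), so left invariance of Haar measure equates their averages. Along paths,
all `|C(V)|` averages agree, and each is `d ^ 2 / |C(V)|`. -/

theorem pauliMatrix_mul_pauliMatrix (a b : Fin 4) :
    ∃ (c : ℂ) (e : Fin 4), pauliMatrix a * pauliMatrix b = c • pauliMatrix e := by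
  refine ⟨(![![1, 1, 1, 1], ![1, 1, Complex.I, -Complex.I], ![1, -Complex.I, 1, Complex.I],
    ![1, Complex.I, -Complex.I, 1]] : Fin 4 → Fin 4 → ℂ) a b,
    (![![0, 1, 2, 3], ![1, 0, 3, 2], ![2, 3, 0, 1], ![3, 2, 1, 0]] : Fin 4 → Fin 4 → Fin 4) a b, ?_⟩
  fin_cases a <;> fin_cases b <;> ext i j <;> fin_cases i <;> fin_cases j <;>
    simp [pauliMatrix, Matrix.mul_apply]

theorem pauliMatrix_commute_or_anticommute (a b : Fin 4) :
    ∃ ε : ℂ, (ε = 1 ∨ ε = -1) ∧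
      pauliMatrix a * pauliMatrix b = ε • (pauliMatrix b * pauliMatrix a) := by
  refine ⟨(![![1, 1, 1, 1], ![1, 1, -1, -1], ![1, -1, 1, -1],
    ![1, -1, -1, 1]] : Fin 4 → Fin 4 → ℂ) a b, ?_, ?_⟩
  · fin_cases a <;> fin_cases b <;> simp
  · fin_cases a <;> fin_cases b <;> ext i j <;> fin_cases i <;> fin_cases j <;>
      simp [pauliMatrix, Matrix.mul_apply]

theorem pauliMatrix_conjTranspose (a : Fin 4) : (pauliMatrix a)ᴴ = pauliMatrix a := by
  fin_cases a <;> ext i j <;> fin_cases i <;> fin_cases j <;> simp [pauliMatrix]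

theorem trace_pauliMatrix_mul (a b : Fin 4) :
    (pauliMatrix a * pauliMatrix b).trace = if a = b then 2 else 0 := by
  fin_cases a <;> fin_cases b <;>
    simp [pauliMatrix, Matrix.trace, Fin.sum_univ_two] <;> norm_num

theorem pauliMatrix_mul_self (a : Fin 4) : pauliMatrix a * pauliMatrix a = 1 := by
  fin_cases a <;> ext i j <;> fin_cases i <;> fin_cases j <;>
    simp [pauliMatrix, Matrix.mul_apply]

namespace PauliString

variable {n : ℕ}

theorem op_mul_op_apply (p q : PauliString n) (i j : Fin n → Fin 2) :
    (p.op * q.op) i j = ∏ k, (pauliMatrix (p k) * pauliMatrix (q k)) (i k) (j k) := by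
  simp only [Matrix.mul_apply, op, Matrix.of_apply, ← Finset.prod_mul_distrib]
  -- A sum over bit strings of a product over qubits factors qubit by qubit.
  rw [Finset.prod_univ_sum, Fintype.piFinset_univ]

theorem op_mul_op (p q : PauliString n) :
    ∃ (c : ℂ) (r : PauliString n), p.op * q.op = c • r.op := by
  choose c e h using pauliMatrix_mul_pauliMatrix
  refine ⟨∏ k, c (p k) (q k), fun k => e (p k) (q k), ?_⟩
  ext i j
  rw [op_mul_op_apply]
  simp only [h, op, Matrix.smul_apply, Matrix.of_apply, smul_eq_mul, Finset.prod_mul_distrib]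

theorem op_commute_or_anticommute (p q : PauliString n) :
    p.op * q.op = q.op * p.op ∨ p.op * q.op = -(q.op * p.op) := by
  choose ε hε h using fun k => pauliMatrix_commute_or_anticommute (p k) (q k)
  have key : p.op * q.op = (∏ k, ε k) • (q.op * p.op) := by
    ext i j
    simp [op_mul_op_apply, h, Finset.prod_mul_distrib]
  have hs : (∏ k, ε k) = 1 ∨ (∏ k, ε k) = -1 := by
    refine Finset.prod_induction ε (fun z => z = 1 ∨ z = -1) ?_ (Or.inl rfl) fun k _ => hε k
    rintro a b (rfl | rfl) (rfl | rfl) <;> simp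
  rcases hs with hs | hs <;> rw [hs] at key <;> simp [key]

theorem op_conjTranspose (p : PauliString n) : p.opᴴ = p.op := by
  ext i j
  simp only [Matrix.conjTranspose_apply, op, Matrix.of_apply, star_prod]
  refine Finset.prod_congr rfl fun k _ => ?_
  rw [← Matrix.conjTranspose_apply, pauliMatrix_conjTranspose]

theorem op_mul_self (p : PauliString n) : p.op * p.op = 1 := by
  ext i j
  simp only [op_mul_op_apply, pauliMatrix_mul_self, Matrix.one_apply, funext_iff]
  by_cases h : ∀ k, i k = j k
  · simp [h]
  · obtain ⟨k, hk⟩ := not_forall.mp h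
    rw [if_neg h, Finset.prod_eq_zero (Finset.mem_univ k) (if_neg hk)]

theorem hsInner_op_op (p q : PauliString n) :
    hsInner p.op q.op = if p = q then 2 ^ n else 0 := by
  have key : hsInner p.op q.op = ∏ k, (pauliMatrix (p k) * pauliMatrix (q k)).trace := by
    simp only [hsInner, op_conjTranspose, Matrix.trace, Matrix.diag_apply, op_mul_op_apply]
    rw [Finset.prod_univ_sum, Fintype.piFinset_univ]
  rw [key]
  simp only [trace_pauliMatrix_mul]
  split_ifs with h
  · simp [h]
  · obtain ⟨k, hk⟩ := Function.ne_iff.mp h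
    exact Finset.prod_eq_zero (Finset.mem_univ k) (if_neg hk)

end PauliString

/-! ### Exponentials and conjugation -/

/-- A subspace stable under the commutator with `X` is stable under conjugation by `exp X`. -/
theorem Submodule.exp_mul_mul_exp_neg_mem {A : Type*} [NormedRing A] [NormedAlgebra ℂ A]
    [FiniteDimensional ℂ A] (S : Submodule ℂ A) (X : A)
    (hX : ∀ Y ∈ S, X * Y - Y * X ∈ S) {Y : A} (hY : Y ∈ S) :
    NormedSpace.exp X * Y * NormedSpace.exp (-X) ∈ S := by
  have : CompleteSpace A := FiniteDimensional.complete ℂ A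
  -- `L + R` is the commutator with `X`; since `L` and `R` commute, its exponential is conjugation
  -- by `exp X`.
  let L : A →L[ℂ] A := ContinuousLinearMap.mul ℂ A X
  let R : A →L[ℂ] A := (ContinuousLinearMap.mul ℂ A).flip (-X)
  have hL1 : ∀ Z, L Z = X * Z := fun Z => rfl
  have hR1 : ∀ Z, R Z = Z * -X := fun Z => rfl
  have hL : ∀ k Z, (L ^ k) Z = X ^ k * Z := by
    intro k
    induction k with
    | zero => simp
    | succ k ih => intro Z; rw [pow_succ, mul_apply_eq_comp, ih, hL1, pow_succ, mul_assoc]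
  have hR : ∀ k Z, (R ^ k) Z = Z * (-X) ^ k := by
    intro k
    induction k with
    | zero => simp
    | succ k ih => intro Z; rw [pow_succ, mul_apply_eq_comp, ih, hR1, pow_succ', mul_assoc]
  have hsum : ∀ (T : A →L[ℂ] A) Z,
      HasSum (fun k : ℕ => ((k.factorial : ℂ)⁻¹) • (T ^ k) Z) (NormedSpace.exp T Z) := fun T Z => by
    have h := (NormedSpace.exp_series_hasSum_exp' (𝕂 := ℂ) T).mapL (ContinuousLinearMap.apply ℂ A Z)
    simpa only [ContinuousLinearMap.apply_apply, _root_.smul_apply] using h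
  have expL : ∀ Z, NormedSpace.exp L Z = NormedSpace.exp X * Z := fun Z => by
    refine (hsum L Z).unique ?_
    simpa only [hL, smul_mul_assoc] using
      (NormedSpace.exp_series_hasSum_exp' (𝕂 := ℂ) X).mul_right Z
  have expR : ∀ Z, NormedSpace.exp R Z = Z * NormedSpace.exp (-X) := fun Z => by
    refine (hsum R Z).unique ?_
    simpa only [hR, mul_smul_comm] using
      (NormedSpace.exp_series_hasSum_exp' (𝕂 := ℂ) (-X)).mul_left Z
  have hc : Commute R L := by
    ext1 Z
    rw [mul_apply_eq_comp, mul_apply_eq_comp, hL1, hR1, hR1, hL1, mul_assoc]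
  have : NormedAlgebra ℚ (A →L[ℂ] A) := NormedAlgebra.restrictScalars ℚ ℂ _
  have hexp : NormedSpace.exp X * Y * NormedSpace.exp (-X) = NormedSpace.exp (R + L) Y := by
    rw [NormedSpace.exp_add_of_commute hc, mul_apply_eq_comp, expL, expR]
  have hstab : ∀ k : ℕ, ((R + L) ^ k) Y ∈ S := by
    intro k
    induction k with
    | zero => simpa
    | succ k ih =>
      rw [pow_succ', mul_apply_eq_comp, _root_.add_apply, hL1, hR1, mul_neg,
        neg_add_eq_sub]
      exact hX _ ih
  rw [hexp]
  exact S.closed_of_finiteDimensional.mem_of_tendsto (hsum (R + L) Y)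
    (Filter.Eventually.of_forall fun s => S.sum_mem fun k _ => S.smul_mem _ (hstab k))

open scoped Matrix.Norms.Operator in
theorem Matrix.exp_mul_mul_exp_neg_mem {m : Type*} [Fintype m] [DecidableEq m]
    (S : Submodule ℂ (Matrix m m ℂ)) (X : Matrix m m ℂ)
    (hX : ∀ Y ∈ S, X * Y - Y * X ∈ S) {Y : Matrix m m ℂ} (hY : Y ∈ S) :
    NormedSpace.exp X * Y * NormedSpace.exp (-X) ∈ S :=
  S.exp_mul_mul_exp_neg_mem X hX hY

/-- The exponential of a multiple of an involution. -/
theorem NormedSpace.exp_smul_of_mul_self {A : Type*} [NormedRing A] [NormedAlgebra ℂ A]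
    {X : A} (hX : X * X = 1) (z : ℂ) :
    NormedSpace.exp (z • X) = Complex.cosh z • (1 : A) + Complex.sinh z • X := by
  -- Functional calculus: `(a, b)` goes to `a (1 + X)/2 + b (1 - X)/2`, where `(1 ± X)/2` are the
  -- spectral idempotents for the eigenvalues `±1`.
  let φ : ℂ × ℂ →+* A :=
    { toFun := fun a => ((a.1 + a.2) / 2) • 1 + ((a.1 - a.2) / 2) • X
      map_one' := by simp
      map_zero' := by simp
      map_add' := fun a b => by simp only [Prod.fst_add, Prod.snd_add]; module
      map_mul' := fun a b => by
        simp only [Prod.fst_mul, Prod.snd_mul, add_mul, mul_add, smul_mul_smul_comm, hX, one_mul,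
          mul_one]
        module }
  have hφ : Continuous φ := by
    change Continuous fun a : ℂ × ℂ => ((a.1 + a.2) / 2) • (1 : A) + ((a.1 - a.2) / 2) • X
    fun_prop
  have h1 : z • X = φ (z, -z) := by
    simp [φ]
  have : NormedAlgebra ℚ A := NormedAlgebra.restrictScalars ℚ ℂ _
  rw [h1, ← NormedSpace.map_exp φ hφ]
  simp [φ, Prod.fst_exp, Prod.snd_exp, Complex.cosh, Complex.sinh, ← Complex.exp_eq_exp_ℂ]

open scoped Matrix.Norms.Operator in
theorem Matrix.exp_smul_of_mul_self {m : Type*} [Fintype m] [DecidableEq m]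
    {X : Matrix m m ℂ} (hX : X * X = 1) (z : ℂ) :
    NormedSpace.exp (z • X) = Complex.cosh z • (1 : Matrix m m ℂ) + Complex.sinh z • X :=
  NormedSpace.exp_smul_of_mul_self hX z

section HilbertSchmidt

variable {n : ℕ}

theorem hsInner_add_right (A B C : QubitOp n) :
    hsInner A (B + C) = hsInner A B + hsInner A C := by
  simp [hsInner, mul_add]

theorem hsInner_smul_right (c : ℂ) (A B : QubitOp n) : hsInner A (c • B) = c * hsInner A B := by
  simp [hsInner]

theorem hsInner_smul_left (c : ℂ) (A B : QubitOp n) :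
    hsInner (c • A) B = star c * hsInner A B := by
  simp [hsInner]

theorem hsInner_conj_symm (A B : QubitOp n) : star (hsInner A B) = hsInner B A := by
  rw [hsInner, hsInner, ← Matrix.trace_conjTranspose]
  simp

theorem hsInner_sum_right {ι : Type*} (s : Finset ι) (A : QubitOp n) (f : ι → QubitOp n) :
    hsInner A (∑ i ∈ s, f i) = ∑ i ∈ s, hsInner A (f i) := by
  simp [hsInner, Finset.mul_sum]

theorem hsInner_mul_mul_conjTranspose_left (U A B : QubitOp n) :
    hsInner (U * A * Uᴴ) B = hsInner A (Uᴴ * B * U) := by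
  simp only [hsInner, Matrix.conjTranspose_mul, Matrix.conjTranspose_conjTranspose]
  rw [mul_assoc, Matrix.trace_mul_comm]
  simp only [mul_assoc]

end HilbertSchmidt

/-! ### Invariance of component spans -/

section Component

attribute [local instance 100] LieRing.ofAssociativeRing

variable {n : ℕ} {𝒢 : Set (PauliString n)}

theorem mem_component_iff {p q : PauliString n} :
    q ∈ component 𝒢 p ↔ component 𝒢 q = component 𝒢 p := by
  rw [component, component, SimpleGraph.ConnectedComponent.supp_inj,
    SimpleGraph.ConnectedComponent.mem_supp_iff]

theorem mem_component_self (p : PauliString n) : p ∈ component 𝒢 p :=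
  mem_component_iff.mpr rfl

/-- The span of the Pauli strings in the component of `p`. -/
def componentSpan (𝒢 : Set (PauliString n)) (p : PauliString n) : Submodule ℂ (QubitOp n) :=
  Submodule.span ℂ (PauliString.op '' component 𝒢 p)

/-- Two strings commute or anticommute; in the latter case the commutator is twice their product, a
multiple of a single string in the same component. -/
theorem commutator_mem_componentSpan {V X : PauliString n} (hX : X ∈ 𝒢) {Y : QubitOp n}
    (hY : Y ∈ componentSpan 𝒢 V) : X.op * Y - Y * X.op ∈ componentSpan 𝒢 V := by
  induction hY using Submodule.span_induction with
  | zero => simp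
  | add A B _ _ hA hB =>
    convert add_mem hA hB using 1
    noncomm_ring
  | smul c A _ hA =>
    convert Submodule.smul_mem _ c hA using 1
    rw [mul_smul_comm, smul_mul_assoc, smul_sub]
  | mem A hA =>
    obtain ⟨p, hp, rfl⟩ := hA
    rcases PauliString.op_commute_or_anticommute p X with h | h
    · simp [h]
    · obtain ⟨c, q, hq⟩ := PauliString.op_mul_op p X
      have hc : p.op * X.op - X.op * p.op = (2 * c) • q.op := by
        rw [mul_smul, ← hq, two_smul, sub_eq_add_neg]
        nth_rw 3 [h]
      rw [← neg_sub, hc, neg_mem_iff]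
      rcases eq_or_ne (2 * c) 0 with h0 | h0
      · simp [h0]
      refine Submodule.smul_mem _ _ (Submodule.subset_span ⟨q, ?_, rfl⟩)
      rcases eq_or_ne p q with rfl | hpq
      · exact hp
      have hadj : (commutatorGraph 𝒢).Adj p q :=
        (SimpleGraph.fromRel_adj _ _ _).mpr ⟨hpq, Or.inl ⟨X, hX, _, h0, hc⟩⟩
      have := SimpleGraph.ConnectedComponent.sound hadj.symm.reachable
      rw [component, SimpleGraph.ConnectedComponent.mem_supp_iff] at hp ⊢
      rw [this, hp]

/-- The operators whose commutators preserve a given subspace. -/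
def commutatorStabilizer {n : ℕ} (S : Submodule ℂ (QubitOp n)) : LieSubalgebra ℝ (QubitOp n) where
  carrier := {B | ∀ Y ∈ S, B * Y - Y * B ∈ S}
  zero_mem' := by simp
  add_mem' {A B} hA hB Y hY := by
    convert add_mem (hA Y hY) (hB Y hY) using 1
    noncomm_ring
  smul_mem' c A hA Y hY := by
    convert S.smul_mem (c : ℂ) (hA Y hY) using 1
    rw [smul_sub, ← Complex.coe_smul, smul_mul_assoc, mul_smul_comm]
  lie_mem' {A B} hA hB Y hY := by
    convert sub_mem (hA _ (hB Y hY)) (hB _ (hA Y hY)) using 1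
    rw [LieRing.of_associative_ring_bracket]
    noncomm_ring

theorem dynamicalLieAlgebra_le_commutatorStabilizer (V : PauliString n) :
    dynamicalLieAlgebra 𝒢 ≤ commutatorStabilizer (componentSpan 𝒢 V) := by
  refine LieSubalgebra.lieSpan_le.mpr ?_
  rintro _ ⟨X, hX, rfl⟩ Y hY
  convert Submodule.smul_mem _ Complex.I (commutator_mem_componentSpan hX hY) using 1
  rw [smul_sub, smul_mul_assoc, mul_smul_comm]

theorem conj_mem_componentSpan {V : PauliString n} (U : dynamicalGroup 𝒢) {Y : QubitOp n}
    (hY : Y ∈ componentSpan 𝒢 V) :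
    (U : QubitOp n) * Y * (U : QubitOp n)ᴴ ∈ componentSpan 𝒢 V := by
  set S := componentSpan 𝒢 V
  have hexp : ∀ (U : Matrix.unitaryGroup (Fin n → Fin 2) ℂ), ∀ X ∈ dynamicalLieAlgebra 𝒢,
      (U : QubitOp n) = NormedSpace.exp X → (U : QubitOp n)ᴴ = NormedSpace.exp (-X) := by
    intro U X _ hUX
    rw [Matrix.exp_neg, ← hUX]
    exact (Matrix.inv_eq_left_inv (Matrix.mem_unitaryGroup_iff'.mp U.2)).symm
  have hstab : ∀ X ∈ dynamicalLieAlgebra 𝒢, ∀ Y ∈ S, X * Y - Y * X ∈ S := fun X hX =>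
    dynamicalLieAlgebra_le_commutatorStabilizer V hX
  -- Both conjugations are carried along so that the induction passes to inverses.
  have hclosure : ∀ U ∈ Subgroup.closure {U : Matrix.unitaryGroup (Fin n → Fin 2) ℂ |
      ∃ X ∈ dynamicalLieAlgebra 𝒢, (U : QubitOp n) = NormedSpace.exp X},
      ∀ Y ∈ S, (U : QubitOp n) * Y * (U : QubitOp n)ᴴ ∈ S ∧
        (U : QubitOp n)ᴴ * Y * (U : QubitOp n) ∈ S := by
    intro U hU
    induction hU using Subgroup.closure_induction with
    | mem U hU =>
      obtain ⟨X, hX, hUX⟩ := hU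
      intro Y hY
      rw [hexp U X hX hUX, hUX]
      refine ⟨Matrix.exp_mul_mul_exp_neg_mem S X (hstab X hX) hY, ?_⟩
      simpa using Matrix.exp_mul_mul_exp_neg_mem S (-X) (hstab _ (neg_mem hX)) hY
    | one => intro Y hY; simpa using hY
    | mul A B _ _ hA hB =>
      intro Y hY
      have h1 := (hA _ (hB Y hY).1).1
      have h2 := (hB _ (hA Y hY).2).2
      simp only [Submonoid.coe_mul, Matrix.conjTranspose_mul, mul_assoc] at h1 h2 ⊢
      exact ⟨h1, h2⟩
    | inv A _ hA =>
      intro Y hY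
      simpa [Matrix.star_eq_conjTranspose] using (hA Y hY).symm
  have hcont : Continuous fun U : Matrix.unitaryGroup (Fin n → Fin 2) ℂ =>
      (U : QubitOp n) * Y * (U : QubitOp n)ᴴ := by fun_prop
  have hS : IsClosed (S : Set (QubitOp n)) := S.closed_of_finiteDimensional
  exact closure_minimal (fun U hU => (hclosure U hU Y hY).1) (hS.preimage hcont) U.2

/-! ### Pauli expansion and Parseval -/

theorem eq_sum_of_mem_componentSpan {V : PauliString n} {M : QubitOp n}
    (hM : M ∈ componentSpan 𝒢 V) :
    M = ∑ q ∈ (component 𝒢 V).toFinite.toFinset, (hsInner q.op M / 2 ^ n) • q.op := by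
  induction hM using Submodule.span_induction with
  | zero => simp [hsInner]
  | add A B _ _ hA hB =>
    conv_lhs => rw [hA, hB]
    simp only [hsInner_add_right, add_div, add_smul, Finset.sum_add_distrib]
  | smul c A _ hA =>
    conv_lhs => rw [hA]
    simp only [hsInner_smul_right, mul_div_assoc, mul_smul, Finset.smul_sum]
  | mem A hA =>
    obtain ⟨p, hp, rfl⟩ := hA
    rw [Finset.sum_eq_single_of_mem p (by simpa using hp)]
    · simp [PauliString.hsInner_op_op]
    · intro q _ hq
      simp [PauliString.hsInner_op_op, hq]

/-- Parseval's identity for the Pauli strings in a component. -/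
theorem sum_norm_hsInner_sq {V : PauliString n} {M : QubitOp n}
    (hM : M ∈ componentSpan 𝒢 V) :
    ∑ q ∈ (component 𝒢 V).toFinite.toFinset, ‖hsInner q.op M‖ ^ 2 =
      2 ^ n * (hsInner M M).re := by
  have h : (2 ^ n : ℂ) * hsInner M M =
      ∑ q ∈ (component 𝒢 V).toFinite.toFinset, ((‖hsInner q.op M‖ ^ 2 : ℝ) : ℂ) := by
    conv_lhs => enter [2, 2]; rw [eq_sum_of_mem_componentSpan hM]
    rw [hsInner_sum_right, Finset.mul_sum]
    refine Finset.sum_congr rfl fun q _ => ?_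
    rw [hsInner_smul_right, ← hsInner_conj_symm q.op M, Complex.star_def, div_mul_eq_mul_div,
      Complex.mul_conj, mul_div_cancel₀ _ (pow_ne_zero n two_ne_zero), Complex.normSq_eq_norm_sq]
  have h2 := congrArg Complex.re h
  rw [← Complex.ofReal_sum, Complex.ofReal_re] at h2
  rw [← h2, ← Complex.re_ofReal_mul]
  push_cast
  rfl

theorem hsInner_eq_zero_of_mem_componentSpan {V W : PauliString n} (hW : W ∉ component 𝒢 V)
    {M : QubitOp n} (hM : M ∈ componentSpan 𝒢 V) : hsInner W.op M = 0 := by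
  rw [eq_sum_of_mem_componentSpan hM, hsInner_sum_right]
  refine Finset.sum_eq_zero fun q hq => ?_
  have : W ≠ q := by rintro rfl; exact hW (by simpa using hq)
  simp [hsInner_smul_right, PauliString.hsInner_op_op, this]

theorem conjTranspose_mul_self_of_dynamicalGroup (U : dynamicalGroup 𝒢) :
    (U : QubitOp n)ᴴ * (U : QubitOp n) = 1 :=
  Matrix.mem_unitaryGroup_iff'.mp U.1.2

theorem evolve_mem_componentSpan (U : dynamicalGroup 𝒢) (V : PauliString n) :
    evolve U V ∈ componentSpan 𝒢 V :=
  conj_mem_componentSpan U (Submodule.subset_span ⟨V, mem_component_self V, rfl⟩)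

theorem hsInner_evolve_evolve (U : dynamicalGroup 𝒢) (V W : PauliString n) :
    hsInner (evolve U V) (evolve U W) = hsInner V.op W.op := by
  have hU := conjTranspose_mul_self_of_dynamicalGroup U
  rw [evolve, hsInner_mul_mul_conjTranspose_left, evolve]
  congr 1
  simp only [mul_assoc, hU, mul_one]
  rw [← mul_assoc, hU, one_mul]

/-- Rotating the test string amounts to a left translation of `U`, which Haar measure does not see.
-/
theorem hsInner_evolve_left (A U : dynamicalGroup 𝒢) (V W : PauliString n) :
    hsInner (evolve A W) (evolve U V) = hsInner W.op (evolve (A⁻¹ * U) V) := by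
  rw [evolve, hsInner_mul_mul_conjTranspose_left]
  congr 1
  simp [evolve, Matrix.star_eq_conjTranspose, mul_assoc]

/-- Some element of the dynamical group rotates a Pauli string to a neighbouring one, up to a
phase. -/
theorem exists_evolve_eq_smul {p q X : PauliString n} (hX : X ∈ 𝒢) {c : ℂ} (hc : c ≠ 0)
    (h : p.op * X.op - X.op * p.op = c • q.op) :
    ∃ (A : dynamicalGroup 𝒢) (z : ℂ), ‖z‖ = 1 ∧ evolve A p = z • q.op := by
  have hXX := X.op_mul_self
  have hqne : q.op ≠ 0 := by
    intro h0
    have := q.op_mul_self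
    simp [h0] at this
  have hanti : p.op * X.op = -(X.op * p.op) := by
    refine (PauliString.op_commute_or_anticommute p X).resolve_left fun hcomm => ?_
    rw [hcomm, sub_self] at h
    exact (smul_ne_zero hc hqne) h.symm
  -- This is `exp (iθX)` at `θ = π/4`. As `X` anticommutes with `p`, conjugation gives `exp (2iθX)
  -- p`, which is `iXp` at this angle.
  set B : QubitOp n := ((√2 / 2 : ℝ) : ℂ) • (1 + Complex.I • X.op) with hB
  have hBstar : Bᴴ = ((√2 / 2 : ℝ) : ℂ) • (1 - Complex.I • X.op) := by
    simp [hB, Matrix.conjTranspose_smul, PauliString.op_conjTranspose, sub_eq_add_neg]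
  have hsq : ((√2 / 2 : ℝ) : ℂ) * ((√2 / 2 : ℝ) : ℂ) = 1 / 2 := by
    rw [← Complex.ofReal_mul, div_mul_div_comm, Real.mul_self_sqrt (by norm_num)]
    norm_num
  have hBexp : B = NormedSpace.exp ((Real.pi / 4 : ℝ) • (Complex.I • X.op)) := by
    rw [← Complex.coe_smul, smul_smul, Matrix.exp_smul_of_mul_self hXX, Complex.cosh_mul_I,
      Complex.sinh_mul_I, ← Complex.ofReal_cos, ← Complex.ofReal_sin, Real.cos_pi_div_four,
      Real.sin_pi_div_four, hB, smul_add, smul_smul]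
  have hBB : B * Bᴴ = 1 := by
    rw [hBstar, hB, smul_mul_smul_comm, hsq]
    have : (1 + Complex.I • X.op) * (1 - Complex.I • X.op) = (2 : ℂ) • (1 : QubitOp n) := by
      simp only [add_mul, mul_sub, smul_mul_smul_comm, hXX, Complex.I_mul_I, one_mul, mul_one]
      module
    rw [this, smul_smul]
    norm_num
  have hBp : B * p.op * Bᴴ = (-Complex.I * c / 2) • q.op := by
    have hc' : (2 : ℂ) • (p.op * X.op) = c • q.op := by
      rw [← h, two_smul, sub_eq_add_neg, ← hanti]
    have hX' : X.op * p.op = -(p.op * X.op) := by rw [hanti, neg_neg]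
    have : (1 + Complex.I • X.op) * p.op * (1 - Complex.I • X.op)
        = -Complex.I • ((2 : ℂ) • (p.op * X.op)) := by
      simp only [add_mul, mul_sub, smul_mul_assoc, mul_smul_comm, smul_smul, hX', one_mul, mul_one,
        neg_mul, mul_assoc, hXX]
      match_scalars
      · linear_combination Complex.I_sq
      · ring
    rw [hBstar, hB, smul_mul_assoc, smul_mul_smul_comm, hsq, this, hc', smul_smul, smul_smul]
    congr 1
    ring
  let A : dynamicalGroup 𝒢 := ⟨⟨B, Matrix.mem_unitaryGroup_iff.mpr hBB⟩,
    Subgroup.le_topologicalClosure _ (Subgroup.subset_closure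
      ⟨_, (dynamicalLieAlgebra 𝒢).smul_mem _ (LieSubalgebra.subset_lieSpan ⟨X, hX, rfl⟩), hBexp⟩)⟩
  have hA : evolve A p = (-Complex.I * c / 2) • q.op := hBp
  refine ⟨A, _, ?_, hA⟩
  -- Conjugation preserves the Hilbert–Schmidt norm and all strings have the same norm, so the
  -- scalar is a phase.
  have hnorm := hsInner_evolve_evolve A p p
  rw [hA, hsInner_smul_left, hsInner_smul_right, PauliString.hsInner_op_op,
    PauliString.hsInner_op_op, if_pos rfl, if_pos rfl, ← mul_assoc,
    mul_eq_right₀ (pow_ne_zero n two_ne_zero),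
    Complex.star_def, Complex.conj_mul'] at hnorm
  have h1 : ‖-Complex.I * c / 2‖ ^ 2 = 1 := by exact_mod_cast hnorm
  exact (pow_eq_one_iff_of_nonneg (norm_nonneg _) two_ne_zero).mp h1

/-! ### Haar averages -/

instance haarProbability_isProbabilityMeasure (𝒢 : Set (PauliString n)) :
    IsProbabilityMeasure (haarProbability 𝒢) :=
  ⟨Measure.haarMeasure_self (K₀ := (⊤ : TopologicalSpace.PositiveCompacts (dynamicalGroup 𝒢)))⟩

instance haarProbability_isMulLeftInvariant (𝒢 : Set (PauliString n)) :
    (haarProbability 𝒢).IsMulLeftInvariant :=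
  Measure.isMulLeftInvariant_haarMeasure _

theorem integrable_norm_hsInner_evolve_sq (V W : PauliString n) :
    Integrable (fun U : dynamicalGroup 𝒢 => ‖hsInner W.op (evolve U V)‖ ^ 2)
      (haarProbability 𝒢) := by
  have hcont : Continuous fun U : dynamicalGroup 𝒢 => ‖hsInner W.op (evolve U V)‖ ^ 2 := by
    unfold hsInner evolve
    fun_prop
  exact hcont.integrable_of_hasCompactSupport (HasCompactSupport.of_compactSpace _)

theorem integral_norm_hsInner_evolve_sq_eq_of_commutator (V : PauliString n)
    {p q X : PauliString n} (hX : X ∈ 𝒢) {c : ℂ} (hc : c ≠ 0)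
    (h : p.op * X.op - X.op * p.op = c • q.op) :
    ∫ U : dynamicalGroup 𝒢, ‖hsInner p.op (evolve U V)‖ ^ 2 ∂(haarProbability 𝒢) =
      ∫ U : dynamicalGroup 𝒢, ‖hsInner q.op (evolve U V)‖ ^ 2 ∂(haarProbability 𝒢) := by
  obtain ⟨A, z, hz, hA⟩ := exists_evolve_eq_smul hX hc h
  rw [← integral_mul_left_eq_self _ A⁻¹]
  refine integral_congr_ae (Filter.Eventually.of_forall fun U => ?_)
  simp only [← hsInner_evolve_left, hA, hsInner_smul_left, norm_mul, norm_star, hz, one_mul]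

theorem integral_norm_hsInner_evolve_sq_eq_of_mem_component (V : PauliString n)
    {p q : PauliString n} (h : p ∈ component 𝒢 q) :
    ∫ U : dynamicalGroup 𝒢, ‖hsInner p.op (evolve U V)‖ ^ 2 ∂(haarProbability 𝒢) =
      ∫ U : dynamicalGroup 𝒢, ‖hsInner q.op (evolve U V)‖ ^ 2 ∂(haarProbability 𝒢) := by
  obtain ⟨w⟩ := SimpleGraph.ConnectedComponent.exact h
  induction w with
  | nil => rfl
  | cons hadj w ih =>
    rw [← ih (SimpleGraph.ConnectedComponent.sound w.reachable)]
    obtain ⟨-, ⟨X, hX, c, hc, h⟩ | ⟨X, hX, c, hc, h⟩⟩ := (SimpleGraph.fromRel_adj _ _ _).mp hadj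
    · exact integral_norm_hsInner_evolve_sq_eq_of_commutator V hX hc h
    · exact (integral_norm_hsInner_evolve_sq_eq_of_commutator V hX hc h).symm

end Component

open Classical in
theorem mainTheorem4 (n : ℕ) (𝒢 : Set (PauliString n)) (V W : PauliString n) :
    Integrable (fun U : dynamicalGroup 𝒢 => ‖hsInner W.op (evolve U V)‖ ^ 2)
      (haarProbability 𝒢) ∧
    ∫ U : dynamicalGroup 𝒢, ‖hsInner W.op (evolve U V)‖ ^ 2 ∂(haarProbability 𝒢) =
      if component 𝒢 V = component 𝒢 W then
        ((2 : ℝ) ^ n) ^ 2 / ((component 𝒢 V).ncard : ℝ)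
      else 0 := by
  refine ⟨integrable_norm_hsInner_evolve_sq V W, ?_⟩
  split_ifs with hVW
  · set s := (component 𝒢 V).toFinite.toFinset with hs
    have hcard : ((component 𝒢 V).ncard : ℝ) ≠ 0 := by
      exact Nat.cast_ne_zero.mpr (Set.ncard_ne_zero_of_mem (mem_component_self V))
    -- Inside the integral, Parseval makes the sum the constant `d * ⟨V, V⟩ = d ^ 2`.
    have hsum : ∑ q ∈ s, ∫ U : dynamicalGroup 𝒢, ‖hsInner q.op (evolve U V)‖ ^ 2
        ∂(haarProbability 𝒢) = ((2 : ℝ) ^ n) ^ 2 := by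
      rw [← integral_finsetSum _ fun q _ => integrable_norm_hsInner_evolve_sq V q]
      simp_rw [hs, sum_norm_hsInner_sq (evolve_mem_componentSpan _ V), hsInner_evolve_evolve,
        PauliString.hsInner_op_op, if_true]
      have : ((2 : ℂ) ^ n).re = 2 ^ n := by exact_mod_cast Complex.ofReal_re (2 ^ n)
      simp [this, sq]
    have hconst : ∀ q ∈ s, ∫ U : dynamicalGroup 𝒢, ‖hsInner q.op (evolve U V)‖ ^ 2
        ∂(haarProbability 𝒢) = ∫ U : dynamicalGroup 𝒢, ‖hsInner W.op (evolve U V)‖ ^ 2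
        ∂(haarProbability 𝒢) := fun q hq =>
      integral_norm_hsInner_evolve_sq_eq_of_mem_component V
        (hVW ▸ (Set.Finite.mem_toFinset _).mp hq)
    rw [Finset.sum_congr rfl hconst, Finset.sum_const, nsmul_eq_mul, hs,
      ← Set.ncard_eq_toFinset_card] at hsum
    rw [eq_div_iff hcard, mul_comm, hsum]
  · have hW : W ∉ component 𝒢 V := fun h => hVW (mem_component_iff.mp h).symm
    simp [hsInner_eq_zero_of_mem_componentSpan hW (evolve_mem_componentSpan _ V)]
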